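/- Let $M,N_{\mathrm t}\ge 0$ and $N_{\mathrm e}\ge 1$ be integers, let $\sigma_{\mathrm e}>0$, $\varepsilon_{\mathrm e}\ge 0$ and $R^{\mathrm{tol}}$ be real numbers, let $\widehat{\mathbf G}\in\mathbb C^{MN_{\mathrm t}\times N_{\mathrm e}}$, and let $\mathbf V\in\mathbb C^{MN_{\mathrm t}\times MN_{\mathrm t}}$ be Hermitian positive semidefinite. Write $\mathbf A\preceq\mathbf B$ if $\mathbf B-\mathbf A$ is Hermitian positive semidefinite. For $\mathbf G\in\mathbb C^{MN_{\mathrm t}\times N_{\mathrm e}}$ and $\mathbf w\in\mathbb C^{MN_{\mathrm t}}$ put $$\mathbf Z_{\mathrm e}(\mathbf G)=\mathbf I+\tfrac{1}{\sigma_{\mathrm e}^2}\mathbf G^H\mathbf V\mathbf G,\qquad R_{\mathrm e}(\mathbf G,\mathbf w)=\log_2\det\Big(\mathbf I+\tfrac{1}{\sigma_{\mathrm e}^2}\mathbf G\,\mathbf Z_{\mathrm e}(\mathbf G)^{-1}\mathbf G^H\mathbf w\mathbf w^H\Big),$$ $$\mathcal U_{\mathrm e}=\{\Delta\mathbf G\in\mathbb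 C^{MN_{\mathrm t}\times N_{\mathrm e}}:\|\Delta\mathbf G\|_F^2\le\varepsilon_{\mathrm e}^2\},\qquad \kappa^{\mathrm{tol}}=\sigma_{\mathrm e}^2\,(2^{R^{\mathrm{tol}}}-1),\qquad \mathbf U_{\mathrm e}=[\widehat{\mathbf G},\mathbf I_{MN_{\mathrm t}}].$$ Constraint C7 on $(\mathbf w,\mathbf V)$ is: the maximum exists and $\max_{\Delta\mathbf G\in\mathcal U_{\mathrm e}}R_{\mathrm e}(\widehat{\mathbf G}+\Delta\mathbf G,\mathbf w)\le R^{\mathrm{tol}}$. Let $\mathbf W\succeq\mathbf 0$ have rank at most $1$. Then $\mathbf W=\mathbf w\mathbf w^H$ for some $\mathbf w\in\mathbb C^{MN_{\mathrm t}}$, and for every such $\mathbf w$ the following hold. (i) If $\varepsilon_{\mathrm e}>0$, then C7 holds if and only if there is a real number $\delta_{\mathrm e}$ such that $$\widetilde{\mathrm{C7}}:\quad \mathbf U_{\mathrm e}^H\Big(\mathbf W-\frac{\kappa^{\mathrm{tol}}}{\sigma_{\mathrm e}^2}\mathbf V\Big)\mathbf U_{\mathrm e}\preceq\mathrm{diag}\Big((\kappa^{\mathrm{tol}}-\delta_{\mathrm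 e})\mathbf 1_{1\times N_{\mathrm e}},\ \frac{\delta_{\mathrm e}}{\varepsilon_{\mathrm e}^2}\mathbf 1_{1\times MN_{\mathrm t}}\Big),\qquad \delta_{\mathrm e}\ge 0.$$ Moreover, the linear matrix inequality $\widetilde{\mathrm{C7}}$ is a convex constraint in $(\mathbf W,\mathbf V,\delta_{\mathrm e})$, i.e., the set of triples of two complex $MN_{\mathrm t}\times MN_{\mathrm t}$ matrices and a real number that satisfy it is convex. (ii) If $\varepsilon_{\mathrm e}=0$ (so that $\mathbf G=\widehat{\mathbf G}$), then C7 holds if and only if $$\mathbf G^H\mathbf W\mathbf G\preceq\kappa^{\mathrm{tol}}\,\mathbf Z_{\mathrm e}(\mathbf G).$$ -/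

import Mathlib

open scoped Matrix MatrixOrder ComplexOrder

noncomputable section

namespace SecureDelivery

variable {n e : Type*} [Fintype n] [DecidableEq n] [Fintype e] [DecidableEq e]

/-- The rank-one matrix `w wᴴ`. -/
def outer (w : n → ℂ) : Matrix n n ℂ := Matrix.vecMulVec w (star w)

open scoped Matrix.Norms.Frobenius in
/-- The uncertainty set: error matrices whose squared Frobenius norm is at most `ε²`. -/
def uncertaintySet (n e : Type*) [Fintype n] [Fintype e] (ε : ℝ) : Set (Matrix n e ℂ) :=
  {ΔG | ‖ΔG‖ ^ 2 ≤ ε ^ 2}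

/-- `Z = I + σ⁻² Gᴴ V G`. -/
def interferenceCov (σ : ℝ) (V : Matrix n n ℂ) (G : Matrix n e ℂ) : Matrix e e ℂ :=
  1 + (1 / σ ^ 2 : ℝ) • (Gᴴ * V * G)

/-- The eavesdropper capacity `log₂ det (I + σ⁻² G Z⁻¹ Gᴴ w wᴴ)`. For `V ⪰ 0` the determinant is a
real number that is at least `1`, so taking the real part only changes the type. -/
def eavesdropperCapacity (σ : ℝ) (V : Matrix n n ℂ) (w : n → ℂ) (G : Matrix n e ℂ) : ℝ :=
  Real.logb 2
    (Matrix.det (1 + (1 / σ ^ 2 : ℝ) •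
      (G * (interferenceCov σ V G)⁻¹ * Gᴴ * outer w))).re

/-- The worst-case secrecy constraint: the maximum over the uncertainty set of the eavesdropper
capacity (with channel `Ghat + ΔG`) exists and is at most `Rtol`. -/
def SecrecyConstraint (σ ε Rtol : ℝ) (Ghat : Matrix n e ℂ) (w : n → ℂ) (V : Matrix n n ℂ) : Prop :=
  ∃ r : ℝ, IsGreatest
      ((fun ΔG => eavesdropperCapacity σ V w (Ghat + ΔG)) '' uncertaintySet n e ε) r ∧
    r ≤ Rtol

/-- `κ = σ² (2 ^ Rtol - 1)`. -/
def kappaTol (σ Rtol : ℝ) : ℝ := σ ^ 2 * ((2 : ℝ) ^ Rtol - 1)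

/-- `U = [Ghat, I]`. -/
def stackedChannel (Ghat : Matrix n e ℂ) : Matrix n (e ⊕ n) ℂ := Matrix.fromCols Ghat 1

/-- The linear matrix inequality in `(W, V, δ)` with `δ ≥ 0`:
`Uᴴ (W - (κ / σ²) V) U ⪯ diag ((κ - δ) 1, (δ / ε²) 1)`, where `≤` is the Loewner order. -/
def RobustLMI (σ ε Rtol : ℝ) (Ghat : Matrix n e ℂ) (W V : Matrix n n ℂ) (δ : ℝ) : Prop :=
  (stackedChannel Ghat)ᴴ * (W - (kappaTol σ Rtol / σ ^ 2 : ℝ) • V) * stackedChannel Ghat ≤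
      Matrix.diagonal (Sum.elim (fun _ : e => ((kappaTol σ Rtol - δ : ℝ) : ℂ))
        (fun _ : n => ((δ / ε ^ 2 : ℝ) : ℂ))) ∧
    0 ≤ δ

/-- The linear matrix inequality `Gᴴ W G ⪯ κ Z`, where `≤` is the Loewner order. -/
def NominalLMI (σ Rtol : ℝ) (G : Matrix n e ℂ) (W V : Matrix n n ℂ) : Prop :=
  Gᴴ * W * G ≤ kappaTol σ Rtol • interferenceCov σ V G

end SecureDelivery

end

/-!
With `h = Gᴴ w` and `Z = I + σ⁻² Gᴴ V G ≻ 0`, the determinant in the capacity is that of a rank-one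
perturbation of the identity, hence equals `1 + σ⁻² hᴴ Z⁻¹ h` (`det_capacity`). So the capacity is at
most `Rtol` iff `hᴴ Z⁻¹ h ≤ κ`, and by the Cauchy–Schwarz inequality for `Z` this says
`h hᴴ ⪯ κ Z` (`outer_le_smul_iff`, `capacity_le_iff`). This equivalence holds for `κ` of either sign
because there is at least one receive antenna. The uncertainty set is compact and the capacity is
continuous, so the maximum always exists and the secrecy constraint says that `h hᴴ ⪯ κ Z` holds at
every `Ghat + ΔG` (`secrecyConstraint_iff`); for `ε = 0` only `ΔG = 0` remains.

For `ε > 0` put `Q = W - (κ / σ²) V`. The inequality at `Ghat + ΔG` reads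
`(Ghat x + ΔG x)ᴴ Q (Ghat x + ΔG x) ≤ κ ‖x‖²` for all `x`, and the vectors `ΔG x` are exactly the `y`
with `‖y‖² ≤ ε² ‖x‖²`: a rank-one `ΔG` reaches each of them, which is why the Frobenius ball serves
as well as the spectral one. The constraint has become an implication between two Hermitian forms in
`(x, y)`, namely that `ε² ‖x‖² - ‖y‖² ≥ 0` implies
`κ ‖x‖² - (Ghat x + y)ᴴ Q (Ghat x + y) ≥ 0`. The S-lemma (`sLemma`) turns it into the existence
of a multiplier `t ≥ 0`, and `δ = t ε²` gives the robust linear matrix inequality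
(`forall_nominalLMI_iff`).
-/

namespace SecureDelivery

variable {n e : Type*} [Fintype n] [Fintype e]

/-! ### Real-valued quadratic forms of complex matrices -/

/-- The real part of `xᴴ A x`; for Hermitian `A` this is `xᴴ A x` itself, as a real number. -/
def hermForm (A : Matrix n n ℂ) (x : n → ℂ) : ℝ := (star x ⬝ᵥ A *ᵥ x).re

lemma hermForm_sub (A B : Matrix n n ℂ) (x : n → ℂ) :
    hermForm (A - B) x = hermForm A x - hermForm B x := by
  simp [hermForm, Matrix.sub_mulVec, dotProduct_sub]

lemma hermForm_smul (c : ℝ) (A : Matrix n n ℂ) (x : n → ℂ) :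
    hermForm (c • A) x = c * hermForm A x := by
  simp [hermForm, Matrix.smul_mulVec, dotProduct_smul]

lemma hermForm_conj (A : Matrix n n ℂ) (B : Matrix n e ℂ) (x : e → ℂ) :
    hermForm (Bᴴ * A * B) x = hermForm A (B *ᵥ x) := by
  simp only [hermForm, ← Matrix.mulVec_mulVec, Matrix.star_mulVec, Matrix.dotProduct_mulVec]

lemma hermForm_diagonal [DecidableEq n] (d : n → ℝ) (x : n → ℂ) :
    hermForm (Matrix.diagonal fun i => (d i : ℂ)) x = ∑ i, d i * ‖x i‖ ^ 2 := by
  simp only [hermForm, dotProduct, Matrix.mulVec_diagonal, Complex.re_sum]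
  refine Finset.sum_congr rfl fun i _ => ?_
  rw [← Complex.normSq_eq_norm_sq, Complex.normSq_apply]
  simp
  ring

lemma hermForm_one [DecidableEq n] (x : n → ℂ) : hermForm 1 x = ∑ i, ‖x i‖ ^ 2 := by
  simpa using hermForm_diagonal (fun _ => 1) x

lemma hermForm_outer (h x : n → ℂ) : hermForm (outer h) x = ‖star h ⬝ᵥ x‖ ^ 2 := by
  rw [hermForm, outer, Matrix.vecMulVec_mulVec, ← Complex.normSq_eq_norm_sq]
  rw [op_smul_eq_smul, dotProduct_smul, Matrix.star_dotProduct x h]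
  simp [Complex.normSq_apply]

lemma hermForm_smul_vec (A : Matrix n n ℂ) (c : ℂ) (x : n → ℂ) :
    hermForm A (c • x) = ‖c‖ ^ 2 * hermForm A x := by
  rw [hermForm, hermForm, Matrix.mulVec_smul, star_smul, smul_dotProduct, dotProduct_smul,
    smul_smul, smul_eq_mul, Complex.star_def, Complex.conj_mul', ← Complex.ofReal_pow,
    Complex.re_ofReal_mul]

/-- Expansion of the square: the two cross terms are complex conjugates of each other. -/
lemma hermForm_add_vec {A : Matrix n n ℂ} (hA : A.IsHermitian) (x y : n → ℂ) :
    hermForm A (x + y) = hermForm A x + hermForm A y + 2 * (star x ⬝ᵥ A *ᵥ y).re := by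
  have : star y ⬝ᵥ A *ᵥ x = star (star x ⬝ᵥ A *ᵥ y) := by
    rw [Matrix.star_dotProduct, Matrix.star_mulVec, hA.eq, ← Matrix.dotProduct_mulVec]
  simp only [hermForm, star_add, Matrix.mulVec_add, dotProduct_add, add_dotProduct, this,
    Complex.add_re, Complex.star_def, Complex.conj_re]
  ring

lemma hermForm_parallelogram (A : Matrix n n ℂ) (x y : n → ℂ) :
    hermForm A (x + y) + hermForm A (x - y) = 2 * hermForm A x + 2 * hermForm A y := by
  simp only [hermForm, star_add, star_sub, Matrix.mulVec_add, Matrix.mulVec_sub, dotProduct_add,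
    add_dotProduct, dotProduct_sub, sub_dotProduct, Complex.add_re, Complex.sub_re]
  ring

lemma posSemidef_iff_hermForm {A : Matrix n n ℂ} (hA : A.IsHermitian) :
    A.PosSemidef ↔ ∀ x, 0 ≤ hermForm A x := by
  rw [Matrix.posSemidef_iff_dotProduct_mulVec]
  refine ⟨fun h x => (Complex.le_def.1 (h.2 x)).1, fun h => ⟨hA, fun x => ?_⟩⟩
  exact Complex.le_def.2 ⟨h x, (hA.im_star_dotProduct_mulVec_self x).symm⟩

lemma le_iff_hermForm {A B : Matrix n n ℂ} (hA : A.IsHermitian) (hB : B.IsHermitian) :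
    A ≤ B ↔ ∀ x, hermForm A x ≤ hermForm B x := by
  rw [Matrix.le_iff, posSemidef_iff_hermForm (hB.sub hA)]
  simp [hermForm_sub]

lemma hermForm_nonneg {A : Matrix n n ℂ} (hA : A.PosSemidef) (x : n → ℂ) : 0 ≤ hermForm A x :=
  (posSemidef_iff_hermForm hA.1).1 hA x

lemma hermForm_pos {A : Matrix n n ℂ} (hA : A.PosDef) {x : n → ℂ} (hx : x ≠ 0) :
    0 < hermForm A x :=
  (Complex.lt_def.1 (hA.dotProduct_mulVec_pos hx)).1

lemma hermForm_inv_mulVec [DecidableEq n] {A : Matrix n n ℂ} (hA : A.PosDef) (x : n → ℂ) :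
    hermForm A (A⁻¹ *ᵥ x) = hermForm A⁻¹ x := by
  rw [← hermForm_conj, hA.inv.1.eq,
    Matrix.nonsing_inv_mul _ ((Matrix.isUnit_iff_isUnit_det _).1 hA.isUnit), one_mul]

lemma isHermitian_outer (w : n → ℂ) : (outer w).IsHermitian :=
  (Matrix.posSemidef_vecMulVec_self_star w).1

/-- If a diagonal entry `W i i` is nonzero, then all columns are multiples of one vector, so
`W j k * W i i = W j i * W i k`, and `w` is column `i` divided by the square root of `W i i`. -/
lemma exists_eq_outer {W : Matrix n n ℂ} (hW : W.PosSemidef) (hr : W.rank ≤ 1) :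
    ∃ w, W = outer w := by
  classical
  by_cases h0 : ∀ i, W i i = 0
  · refine ⟨0, ?_⟩
    rw [hW.trace_eq_zero_iff.1 (by simp [Matrix.trace, h0])]
    simp [outer]
  push Not at h0
  obtain ⟨i, hi⟩ := h0
  obtain ⟨v, hv⟩ := finrank_le_one_iff.1 hr
  have hcol : ∀ k, ∃ c : ℂ, ∀ j, W j k = c * (v : n → ℂ) j := by
    intro k
    obtain ⟨c, hc⟩ := hv ⟨W.mulVecLin (Pi.single k 1), LinearMap.mem_range_self _ _⟩
    refine ⟨c, fun j => ?_⟩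
    have := congrFun (congrArg Subtype.val hc) j
    simpa using this.symm
  choose c hc using hcol
  obtain ⟨ha, ha'⟩ := Complex.le_def.1 (hW.diag_nonneg (i := i))
  set a : ℝ := (W i i).re with hadef
  have hia : W i i = (a : ℂ) := Complex.ext rfl (by simpa using ha'.symm)
  have hapos : 0 < a := lt_of_le_of_ne ha fun h => hi (by rw [hia, ← h]; simp)
  refine ⟨fun j => W j i / (Real.sqrt a : ℝ), ?_⟩
  have hs : ((Real.sqrt a : ℝ) : ℂ) * (Real.sqrt a : ℝ) = W i i := by
    rw [hia, ← Complex.ofReal_mul, Real.mul_self_sqrt hapos.le]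
  ext j k
  have hki : star (W k i) = W i k := hW.1.apply i k
  simp only [outer, Matrix.vecMulVec_apply, Pi.star_apply, star_div₀, hki]
  rw [show star ((Real.sqrt a : ℝ) : ℂ) = (Real.sqrt a : ℝ) from Complex.conj_ofReal _,
    div_mul_div_comm, hs, eq_div_iff hi, hc k j, hc i i, hc i j, hc k i]
  ring

/-! ### The S-lemma for Hermitian forms -/

lemma exists_mul_re_eq_zero (β : ℂ) : ∃ c : ℂ, c ≠ 0 ∧ (c * β).re = 0 := by
  by_cases h : β = 0
  · exact ⟨1, one_ne_zero, by simp [h]⟩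
  · refine ⟨Complex.I * star β, by simp [h], ?_⟩
    simp
    ring

/-- The core of the S-lemma. After rescaling `x` and `y` so that `G` takes opposite values on them
and rotating `y` so that the cross term of `G` vanishes, `G` is zero on both `x + y` and `x - y`.
There `F` is nonnegative, and the parallelogram law adds the two values up. -/
lemma hermForm_cross_nonneg {F G : Matrix n n ℂ} (hG : G.IsHermitian)
    (h : ∀ z, 0 ≤ hermForm G z → 0 ≤ hermForm F z) {x y : n → ℂ}
    (hx : 0 < hermForm G x) (hy : hermForm G y < 0) :
    0 ≤ hermForm F x * -hermForm G y + hermForm F y * hermForm G x := by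
  obtain ⟨c, hc0, hc⟩ := exists_mul_re_eq_zero (star x ⬝ᵥ G *ᵥ y)
  set p := Real.sqrt (‖c‖ ^ 2 * -hermForm G y)
  set q := Real.sqrt (hermForm G x)
  have hcn : 0 < ‖c‖ ^ 2 := by positivity
  have hp : p ^ 2 = ‖c‖ ^ 2 * -hermForm G y :=
    Real.sq_sqrt (mul_nonneg hcn.le (neg_pos.2 hy).le)
  have hq : q ^ 2 = hermForm G x := Real.sq_sqrt hx.le
  set X : n → ℂ := (p : ℂ) • x
  set Y : n → ℂ := ((q : ℂ) * c) • y
  have hX (A : Matrix n n ℂ) : hermForm A X = p ^ 2 * hermForm A x := by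
    rw [hermForm_smul_vec, Complex.norm_real, Real.norm_eq_abs, sq_abs]
  have hY (A : Matrix n n ℂ) : hermForm A Y = q ^ 2 * ‖c‖ ^ 2 * hermForm A y := by
    simp [Y, hermForm_smul_vec, mul_pow]
  have hcross : (star X ⬝ᵥ G *ᵥ Y).re = 0 := by
    have : star X ⬝ᵥ G *ᵥ Y = ((p * q : ℝ) : ℂ) * (c * (star x ⬝ᵥ G *ᵥ y)) := by
      simp only [X, Y, star_smul, Matrix.mulVec_smul, smul_dotProduct, dotProduct_smul, smul_eq_mul,
        Complex.star_def, Complex.conj_ofReal]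
      push_cast
      ring
    rw [this, Complex.re_ofReal_mul, hc, mul_zero]
  have hplus : hermForm G (X + Y) = 0 := by
    rw [hermForm_add_vec hG, hX, hY, hcross, hp, hq]; ring
  have hminus : hermForm G (X - Y) = 0 := by
    have := hermForm_parallelogram G X Y
    rw [hplus, hX, hY, hp, hq] at this
    linarith
  have hF := hermForm_parallelogram F X Y
  have h1 := h _ hplus.ge
  have h2 := h _ hminus.ge
  rw [hX, hY, hp, hq] at hF
  refine nonneg_of_mul_nonneg_right (a := ‖c‖ ^ 2) ?_ hcn
  linarith

/-- The S-lemma for complex Hermitian forms: under the Slater condition, `F` is nonnegative wherever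
`G` is iff `F ⪰ t G` for some `t ≥ 0`. The multiplier is the infimum of `F z / G z` over the `z` at
which `G` is positive. -/
theorem sLemma {F G : Matrix n n ℂ} (hF : F.IsHermitian) (hG : G.IsHermitian)
    (hslater : ∃ z, 0 < hermForm G z) :
    (∀ z, 0 ≤ hermForm G z → 0 ≤ hermForm F z) ↔ ∃ t : ℝ, 0 ≤ t ∧ t • G ≤ F := by
  have hle (t : ℝ) : t • G ≤ F ↔ ∀ z, t * hermForm G z ≤ hermForm F z := by
    rw [le_iff_hermForm (hG.smul (IsSelfAdjoint.all t)) hF]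
    simp [hermForm_smul]
  refine ⟨fun h => ?_, fun ⟨t, ht, hGF⟩ z hz =>
    (mul_nonneg ht hz).trans ((hle t).1 hGF z)⟩
  obtain ⟨z₀, hz₀⟩ := hslater
  let S : Set ℝ := (fun z => hermForm F z / hermForm G z) '' {z | 0 < hermForm G z}
  have hSne : S.Nonempty := ⟨_, z₀, hz₀, rfl⟩
  have hS0 : ∀ s ∈ S, 0 ≤ s := by
    rintro _ ⟨z, hz, rfl⟩
    exact div_nonneg (h z (le_of_lt hz)) (le_of_lt hz)
  refine ⟨sInf S, le_csInf hSne hS0, (hle _).2 fun z => ?_⟩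
  rcases lt_trichotomy (hermForm G z) 0 with hz | hz | hz
  · have : hermForm F z / hermForm G z ≤ sInf S := by
      refine le_csInf hSne ?_
      rintro _ ⟨x, hx, rfl⟩
      have hx' : 0 < hermForm G x := hx
      have := hermForm_cross_nonneg hG h hx' hz
      rw [div_le_iff_of_neg hz, div_mul_eq_mul_div, div_le_iff₀ hx']
      linarith
    rwa [div_le_iff_of_neg hz] at this
  · simpa [hz] using h z hz.ge
  · have : sInf S ≤ hermForm F z / hermForm G z :=
      csInf_le ⟨0, fun s hs => hS0 s hs⟩ ⟨z, hz, rfl⟩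
    rwa [le_div_iff₀ hz] at this

/-! ### The capacity at a fixed channel -/

/-- The Cauchy–Schwarz inequality `|hᴴ x|² ≤ (hᴴ Z⁻¹ h) (xᴴ Z x)` for positive definite `Z`. -/
lemma norm_sq_dotProduct_le [DecidableEq e] {Z : Matrix e e ℂ} (hZ : Z.PosDef) (h x : e → ℂ) :
    ‖star h ⬝ᵥ x‖ ^ 2 ≤ hermForm Z⁻¹ h * hermForm Z x := by
  have hZu : Z *ᵥ (Z⁻¹ *ᵥ h) = h := by
    rw [Matrix.mulVec_mulVec,
      Matrix.mul_nonsing_inv _ ((Matrix.isUnit_iff_isUnit_det _).1 hZ.isUnit), Matrix.one_mulVec]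
  set β := star h ⬝ᵥ x
  have hβ : star x ⬝ᵥ h = star β := Matrix.star_dotProduct x h
  -- `Z` is nonnegative on the vectors `x + t β Z⁻¹ h`, where its value is quadratic in `t`.
  have hquad (t : ℝ) : 0 ≤ ‖β‖ ^ 2 * hermForm Z⁻¹ h * (t * t) + 2 * ‖β‖ ^ 2 * t + hermForm Z x := by
    have := hermForm_nonneg hZ.posSemidef (x + ((t : ℂ) * β) • (Z⁻¹ *ᵥ h))
    rw [hermForm_add_vec hZ.1, hermForm_smul_vec, Matrix.mulVec_smul, hZu, dotProduct_smul,
      hermForm_inv_mulVec hZ, hβ,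
      smul_eq_mul, mul_assoc, Complex.star_def, Complex.mul_conj, Complex.normSq_eq_norm_sq,
      ← Complex.ofReal_mul, Complex.ofReal_re, norm_mul, mul_pow, Complex.norm_real,
      Real.norm_eq_abs, sq_abs] at this
    linarith
  have hd := discrim_le_zero hquad
  rcases eq_or_ne β 0 with h0 | h0
  · rw [h0, norm_zero, zero_pow two_ne_zero]
    exact mul_nonneg (hermForm_nonneg hZ.inv.posSemidef h) (hermForm_nonneg hZ.posSemidef x)
  · have hb : 0 < ‖β‖ ^ 2 := by positivity
    rw [discrim] at hd
    refine le_of_mul_le_mul_left ?_ hb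
    linarith

/-- The index type has to be nonempty: for `h = 0` the left side forces `0 ≤ κ` only through a
nonzero test vector. For `h ≠ 0` the test vector is `Z⁻¹ h`. -/
lemma outer_le_smul_iff [DecidableEq e] [Nonempty e] {Z : Matrix e e ℂ} (hZ : Z.PosDef)
    (h : e → ℂ) (κ : ℝ) :
    outer h ≤ κ • Z ↔ hermForm Z⁻¹ h ≤ κ := by
  rw [le_iff_hermForm (isHermitian_outer h) (hZ.1.smul (IsSelfAdjoint.all κ))]
  simp only [hermForm_outer, hermForm_smul]
  refine ⟨fun H => ?_, fun H x => (norm_sq_dotProduct_le hZ h x).trans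
    (mul_le_mul_of_nonneg_right H (hermForm_nonneg hZ.posSemidef x))⟩
  rcases eq_or_ne h 0 with rfl | h0
  · have hk : 0 ≤ κ :=
      nonneg_of_mul_nonneg_left ((sq_nonneg _).trans (H 1)) (hermForm_pos hZ one_ne_zero)
    simpa [hermForm] using hk
  · have hqpos := hermForm_pos hZ.inv h0
    have := H (Z⁻¹ *ᵥ h)
    rw [hermForm_inv_mulVec hZ] at this
    have h2 : hermForm Z⁻¹ h ≤ ‖star h ⬝ᵥ Z⁻¹ *ᵥ h‖ := Complex.re_le_norm _
    refine le_of_mul_le_mul_right ?_ hqpos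
    refine le_trans ?_ this
    rw [← sq]
    gcongr

lemma posDef_interferenceCov [DecidableEq e] (σ : ℝ) {V : Matrix n n ℂ} (hV : V.PosSemidef)
    (G : Matrix n e ℂ) : (interferenceCov σ V G).PosDef := by
  refine Matrix.PosDef.one.add_posSemidef ?_
  exact (hV.conjTranspose_mul_mul_same G).smul (by positivity)

lemma conj_outer {m : Type*} (G : Matrix n m ℂ) (w : n → ℂ) :
    Gᴴ * outer w * G = outer (Gᴴ *ᵥ w) := by
  rw [outer, Matrix.mul_vecMulVec, Matrix.vecMulVec_mul, outer, Matrix.star_mulVec,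
    Matrix.conjTranspose_conjTranspose]

lemma det_capacity [DecidableEq n] [DecidableEq e] (σ : ℝ) (Z : Matrix e e ℂ) (w : n → ℂ)
    (G : Matrix n e ℂ) :
    (Matrix.det (1 + (1 / σ ^ 2 : ℝ) • (G * Z⁻¹ * Gᴴ * outer w))).re =
      1 + 1 / σ ^ 2 * hermForm Z⁻¹ (Gᴴ *ᵥ w) := by
  rw [outer, Matrix.mul_vecMulVec, ← Matrix.smul_vecMulVec, Matrix.vecMulVec_eq Unit,
    Matrix.det_one_add_replicateCol_mul_replicateRow, dotProduct_smul, Complex.add_re,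
    Complex.one_re, Complex.smul_re, smul_eq_mul, hermForm, Matrix.star_mulVec,
    Matrix.conjTranspose_conjTranspose, ← Matrix.dotProduct_mulVec]
  simp only [Matrix.mulVec_mulVec, Matrix.mul_assoc]

lemma one_le_det_capacity [DecidableEq e] (σ : ℝ) {V : Matrix n n ℂ} (hV : V.PosSemidef) (w : n → ℂ)
    (G : Matrix n e ℂ) :
    1 ≤ 1 + 1 / σ ^ 2 * hermForm (interferenceCov σ V G)⁻¹ (Gᴴ *ᵥ w) := by
  have := hermForm_nonneg (posDef_interferenceCov σ hV G).inv.posSemidef (Gᴴ *ᵥ w)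
  have : 0 ≤ 1 / σ ^ 2 * hermForm (interferenceCov σ V G)⁻¹ (Gᴴ *ᵥ w) := by positivity
  linarith

lemma capacity_le_iff [DecidableEq n] [DecidableEq e] [Nonempty e] {σ : ℝ} (hσ : 0 < σ)
    (Rtol : ℝ) {V : Matrix n n ℂ} (hV : V.PosSemidef) (w : n → ℂ) (G : Matrix n e ℂ) :
    eavesdropperCapacity σ V w G ≤ Rtol ↔ NominalLMI σ Rtol G (outer w) V := by
  rw [eavesdropperCapacity, det_capacity, NominalLMI, conj_outer,
    outer_le_smul_iff (posDef_interferenceCov σ hV G),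
    Real.logb_le_iff_le_rpow one_lt_two (one_pos.trans_le (one_le_det_capacity σ hV w G)),
    kappaTol, one_div, ← le_sub_iff_add_le', inv_mul_le_iff₀ (by positivity)]

/-! ### The secrecy constraint as a family of matrix inequalities -/

lemma continuous_capacity [DecidableEq n] [DecidableEq e] (σ : ℝ) {V : Matrix n n ℂ}
    (hV : V.PosSemidef) (w : n → ℂ) :
    Continuous fun G : Matrix n e ℂ => eavesdropperCapacity σ V w G := by
  have hZ : Continuous fun G : Matrix n e ℂ => interferenceCov σ V G := by
    unfold interferenceCov
    fun_prop
  have hinv : Continuous fun G : Matrix n e ℂ => (interferenceCov σ V G)⁻¹ := by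
    simp only [Matrix.inv_def, Ring.inverse_eq_inv']
    refine Continuous.smul (hZ.matrix_det.inv₀ fun G => ?_) hZ.matrix_adjugate
    exact ((Matrix.isUnit_iff_isUnit_det _).1 (posDef_interferenceCov σ hV G).isUnit).ne_zero
  unfold eavesdropperCapacity
  refine Real.continuousOn_logb.comp_continuous ?_ fun G => ?_
  · fun_prop
  · show _ ≠ _
    rw [det_capacity]
    exact (one_pos.trans_le (one_le_det_capacity σ hV w G)).ne'

lemma mem_uncertaintySet {ε : ℝ} {D : Matrix n e ℂ} :
    D ∈ uncertaintySet n e ε ↔ ∑ i, ∑ j, ‖D i j‖ ^ 2 ≤ ε ^ 2 := by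
  rw [uncertaintySet, Set.mem_ofPred_eq, Matrix.frobenius_norm_def, ← Real.rpow_natCast,
    ← Real.rpow_mul (by positivity)]
  norm_num

lemma uncertaintySet_zero : uncertaintySet n e 0 = {0} := by
  ext D
  simp only [mem_uncertaintySet, Set.mem_singleton_iff, zero_pow two_ne_zero]
  refine ⟨fun h => ?_, fun h => by simp [h]⟩
  have hsum := (Finset.sum_eq_zero_iff_of_nonneg fun i _ => by positivity).1
    (h.antisymm (by positivity))
  ext i j
  have := (Finset.sum_eq_zero_iff_of_nonneg fun j _ => by positivity).1
    (hsum i (Finset.mem_univ i)) j (Finset.mem_univ j)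
  simpa using this

lemma isCompact_uncertaintySet (ε : ℝ) : IsCompact (uncertaintySet n e ε) := by
  -- The product topology on matrices is used, so the ball is described by its entries.
  have hcl : IsClosed (uncertaintySet n e ε) := by
    have : uncertaintySet n e ε = {D | ∑ i, ∑ j, ‖D i j‖ ^ 2 ≤ ε ^ 2} :=
      Set.ext fun D => mem_uncertaintySet
    rw [this]
    exact isClosed_le (by fun_prop) continuous_const
  have hbox : IsCompact (Set.univ.pi fun _ : n => Set.univ.pi fun _ : e =>
      Metric.closedBall (0 : ℂ) |ε|) :=
    isCompact_univ_pi fun _ => isCompact_univ_pi fun _ => isCompact_closedBall _ _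
  refine hbox.of_isClosed_subset hcl fun D hD i _ j _ => ?_
  replace hD := mem_uncertaintySet.1 hD
  rw [mem_closedBall_zero_iff, ← abs_norm, ← sq_le_sq]
  refine le_trans ?_ hD
  refine le_trans ?_ (Finset.single_le_sum (f := fun i => ∑ j, ‖D i j‖ ^ 2)
    (fun i _ => by positivity) (Finset.mem_univ i))
  exact Finset.single_le_sum (f := fun j => ‖D i j‖ ^ 2)
    (fun j _ => by positivity) (Finset.mem_univ j)

lemma secrecyConstraint_iff [DecidableEq n] [DecidableEq e] [Nonempty e] {σ : ℝ} (hσ : 0 < σ)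
    (ε Rtol : ℝ) (Ghat : Matrix n e ℂ) (w : n → ℂ) {V : Matrix n n ℂ} (hV : V.PosSemidef) :
    SecrecyConstraint σ ε Rtol Ghat w V ↔
      ∀ D ∈ uncertaintySet n e ε, NominalLMI σ Rtol (Ghat + D) (outer w) V := by
  simp only [← capacity_le_iff hσ Rtol hV]
  constructor
  · rintro ⟨r, hr, hle⟩ D hD
    exact (hr.2 ⟨D, hD, rfl⟩).trans hle
  · intro h
    have hne : (uncertaintySet n e ε).Nonempty :=
      ⟨0, mem_uncertaintySet.2 (by simpa using sq_nonneg ε)⟩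
    obtain ⟨r, hr⟩ := ((isCompact_uncertaintySet ε).image
      ((continuous_capacity σ hV w).comp (continuous_const.add continuous_id))).exists_isGreatest
        (hne.image _)
    refine ⟨r, hr, ?_⟩
    obtain ⟨D, hD, rfl⟩ := hr.1
    exact h D hD

/-! ### The robust linear matrix inequality -/

/-- The vectors `D x`, with `D` in the Frobenius ball of radius `ε`, fill the ball of radius `ε ‖x‖`:
for `x ≠ 0` the rank-one matrix `y xᴴ / ‖x‖²` maps `x` to `y`. -/
lemma exists_mem_uncertaintySet_mulVec_eq_iff {ε : ℝ} (x : e → ℂ) (y : n → ℂ) :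
    (∃ D ∈ uncertaintySet n e ε, D *ᵥ x = y) ↔ ∑ i, ‖y i‖ ^ 2 ≤ ε ^ 2 * ∑ j, ‖x j‖ ^ 2 := by
  constructor
  · rintro ⟨D, hD, rfl⟩
    rw [mem_uncertaintySet] at hD
    calc ∑ i, ‖(D *ᵥ x) i‖ ^ 2 ≤ ∑ i, (∑ j, ‖D i j‖ ^ 2) * ∑ j, ‖x j‖ ^ 2 := by
          refine Finset.sum_le_sum fun i _ => ?_
          refine le_trans ?_ (Finset.sum_mul_sq_le_sq_mul_sq _ _ _)
          gcongr
          exact (norm_sum_le _ _).trans_eq (by simp)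
      _ = (∑ i, ∑ j, ‖D i j‖ ^ 2) * ∑ j, ‖x j‖ ^ 2 := (Finset.sum_mul _ _ _).symm
      _ ≤ _ := by gcongr
  · intro h
    set s := ∑ j, ‖x j‖ ^ 2 with hs
    have hxx : star x ⬝ᵥ x = (s : ℂ) := by
      simp [hs, dotProduct, Complex.conj_mul']
    rcases (show 0 ≤ s by positivity).eq_or_lt with h0 | hpos
    · have hy : y = 0 := by
        rw [← h0, mul_zero] at h
        have := (Finset.sum_eq_zero_iff_of_nonneg (fun i _ => by positivity)).1
          (h.antisymm (by positivity))
        ext i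
        simpa using this i (Finset.mem_univ i)
      have hx : x = 0 := by
        have := (Finset.sum_eq_zero_iff_of_nonneg (fun i _ => by positivity)).1 (hs ▸ h0.symm)
        ext i
        simpa using this i (Finset.mem_univ i)
      exact ⟨0, mem_uncertaintySet.2 (by simpa using sq_nonneg ε), by simp [hy]⟩
    · refine ⟨(s : ℂ)⁻¹ • Matrix.vecMulVec y (star x), mem_uncertaintySet.2 ?_, ?_⟩
      · have : ∑ i, ∑ j, ‖((s : ℂ)⁻¹ • Matrix.vecMulVec y (star x)) i j‖ ^ 2
            = (∑ i, ‖y i‖ ^ 2) / s := by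
          simp only [Matrix.smul_apply, Matrix.vecMulVec_apply, Pi.star_apply, smul_eq_mul,
            norm_mul, norm_inv, norm_star, Complex.norm_real, Real.norm_eq_abs, mul_pow, inv_pow,
            sq_abs, ← Finset.mul_sum, ← Finset.sum_mul, ← hs]
          field_simp
        rw [this, div_le_iff₀ hpos]
        exact h
      · have hs0 : (s : ℂ) ≠ 0 := by exact_mod_cast hpos.ne'
        ext i
        simp [Matrix.smul_mulVec, Matrix.vecMulVec_mulVec, hxx]
        field_simp

/-- The term `κ σ⁻² Gᴴ V G` of `κ Z` is moved to the left, where it joins `Gᴴ W G`. -/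
lemma nominalLMI_iff [DecidableEq e] {σ : ℝ} (hσ : 0 < σ) (Rtol : ℝ) (G : Matrix n e ℂ)
    {W V : Matrix n n ℂ}
    (hW : W.IsHermitian) (hV : V.IsHermitian) :
    NominalLMI σ Rtol G W V ↔ ∀ x, hermForm (W - (kappaTol σ Rtol / σ ^ 2) • V) (G *ᵥ x) ≤
      kappaTol σ Rtol * ∑ j, ‖x j‖ ^ 2 := by
  have hZ : (interferenceCov σ V G).IsHermitian :=
    Matrix.isHermitian_one.add
      ((Matrix.isHermitian_conjTranspose_mul_mul G hV).smul (IsSelfAdjoint.all _))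
  rw [NominalLMI, le_iff_hermForm (Matrix.isHermitian_conjTranspose_mul_mul G hW)
    (hZ.smul (IsSelfAdjoint.all _))]
  refine forall_congr' fun x => ?_
  have : hermForm (interferenceCov σ V G) x =
      ∑ j, ‖x j‖ ^ 2 + 1 / σ ^ 2 * hermForm V (G *ᵥ x) := by
    rw [← hermForm_one, ← hermForm_conj, ← hermForm_smul, interferenceCov]
    simp [hermForm, Matrix.add_mulVec, dotProduct_add]
  rw [hermForm_conj, hermForm_smul, this, hermForm_sub, hermForm_smul, sub_le_iff_le_add, mul_add]
  field_simp

/-- The S-lemma is applied on vectors `(x, y)` to the form `F`, given by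
`κ ‖x‖² - (Ghat x + y)ᴴ (W - (κ / σ²) V) (Ghat x + y)`, and the form `G`, given by
`ε² ‖x‖² - ‖y‖²`. -/
lemma forall_nominalLMI_iff [DecidableEq n] [DecidableEq e] [Nonempty e] {σ ε : ℝ} (hσ : 0 < σ)
    (hε : 0 < ε) (Rtol : ℝ) (Ghat : Matrix n e ℂ) {W V : Matrix n n ℂ}
    (hW : W.IsHermitian) (hV : V.IsHermitian) :
    (∀ D ∈ uncertaintySet n e ε, NominalLMI σ Rtol (Ghat + D) W V) ↔
      ∃ δ : ℝ, RobustLMI σ ε Rtol Ghat W V δ := by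
  set κ := kappaTol σ Rtol
  set Q := W - (κ / σ ^ 2) • V with hQdef
  have hQ : Q.IsHermitian := hW.sub (hV.smul (IsSelfAdjoint.all _))
  set U := stackedChannel Ghat
  have hdiag (d : e ⊕ n → ℝ) : (Matrix.diagonal fun i => (d i : ℂ)).IsHermitian :=
    Matrix.isHermitian_diagonal_of_self_adjoint _ (funext fun i => Complex.conj_ofReal _)
  set F : Matrix (e ⊕ n) (e ⊕ n) ℂ :=
    Matrix.diagonal (fun i => ((Sum.elim (fun _ => κ) (fun _ => 0) i : ℝ) : ℂ)) - Uᴴ * Q * U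
  set G : Matrix (e ⊕ n) (e ⊕ n) ℂ :=
    Matrix.diagonal (fun i => ((Sum.elim (fun _ => ε ^ 2) (fun _ => -1) i : ℝ) : ℂ))
  have hF : F.IsHermitian := (hdiag _).sub (Matrix.isHermitian_conjTranspose_mul_mul U hQ)
  have hFx (x : e → ℂ) (y : n → ℂ) : hermForm F (Sum.elim x y) =
      κ * ∑ j, ‖x j‖ ^ 2 - hermForm Q (Ghat *ᵥ x + y) := by
    rw [hermForm_sub, hermForm_diagonal, hermForm_conj]
    simp [U, stackedChannel, Finset.mul_sum]
  have hGx (x : e → ℂ) (y : n → ℂ) : hermForm G (Sum.elim x y) =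
      ε ^ 2 * ∑ j, ‖x j‖ ^ 2 - ∑ i, ‖y i‖ ^ 2 := by
    rw [hermForm_diagonal]
    simp [Finset.mul_sum, sub_eq_add_neg]
  have hslater : ∃ z, 0 < hermForm G z := by
    refine ⟨Sum.elim 1 0, ?_⟩
    rw [hGx]
    simp
    positivity
  -- The S-lemma multiplier `t` corresponds to `δ = t ε²`.
  have hrobust (t : ℝ) : RobustLMI σ ε Rtol Ghat W V (t * ε ^ 2) ↔ 0 ≤ t ∧ t • G ≤ F := by
    rw [RobustLMI, and_comm, mul_nonneg_iff_of_pos_right (by positivity : 0 < ε ^ 2), Matrix.le_iff,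
      Matrix.le_iff]
    refine and_congr_right fun _ => ?_
    rw [show F - t • G = Matrix.diagonal (Sum.elim (fun _ : e => ((κ - t * ε ^ 2 : ℝ) : ℂ))
        (fun _ : n => ((t * ε ^ 2 / ε ^ 2 : ℝ) : ℂ))) - Uᴴ * Q * U from ?_]
    simp only [F, G]
    rw [sub_right_comm]
    congr 1
    rw [← Matrix.diagonal_smul, Matrix.diagonal_sub]
    congr 1
    funext i
    rcases i with i | i <;> simp [hε.ne']
  have hex : (∃ δ : ℝ, RobustLMI σ ε Rtol Ghat W V δ) ↔ ∃ t : ℝ, 0 ≤ t ∧ t • G ≤ F := by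
    simp only [← hrobust]
    refine ⟨fun ⟨δ, h⟩ => ⟨δ / ε ^ 2, ?_⟩, fun ⟨t, h⟩ => ⟨_, h⟩⟩
    rwa [div_mul_cancel₀ _ (by positivity)]
  rw [hex, ← sLemma hF (hdiag _) hslater]
  simp only [nominalLMI_iff hσ Rtol _ hW hV, Matrix.add_mulVec]
  constructor
  · intro h z hz
    obtain ⟨x, y, rfl⟩ : ∃ x y, z = Sum.elim x y := ⟨_, _, (Sum.elim_comp_inl_inr z).symm⟩
    rw [hGx, sub_nonneg] at hz
    obtain ⟨D, hD, rfl⟩ := (exists_mem_uncertaintySet_mulVec_eq_iff x y).2 hz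
    rw [hFx, sub_nonneg]
    exact h D hD x
  · intro h D hD x
    have := h (Sum.elim x (D *ᵥ x)) (by
      rw [hGx, sub_nonneg]
      exact (exists_mem_uncertaintySet_mulVec_eq_iff x _).1 ⟨D, hD, rfl⟩)
    rwa [hFx, sub_nonneg] at this

lemma convex_robustLMI {m : Type*} [DecidableEq n] [DecidableEq m] (σ ε Rtol : ℝ)
    (Ghat : Matrix n m ℂ) :
    Convex ℝ {p : Matrix n n ℂ × Matrix n n ℂ × ℝ |
      RobustLMI σ ε Rtol Ghat p.1 p.2.1 p.2.2} := by
  rintro ⟨W₁, V₁, δ₁⟩ ⟨h₁, hδ₁⟩ ⟨W₂, V₂, δ₂⟩ ⟨h₂, hδ₂⟩ a b ha hb hab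
  refine ⟨?_, by simp only [Prod.snd_add, Prod.smul_snd, smul_eq_mul] at *; positivity⟩
  rw [Matrix.le_iff] at *
  convert (h₁.smul ha).add (h₂.smul hb) using 1
  simp only [Prod.fst_add, Prod.smul_fst, Prod.snd_add, Prod.smul_snd, smul_eq_mul]
  set κ := kappaTol σ Rtol
  rw [smul_sub, smul_sub, sub_add_sub_comm, ← Matrix.diagonal_smul, ← Matrix.diagonal_smul,
    Matrix.diagonal_add]
  congr 1
  · congr 1
    funext i
    -- The constant `κ` in the right-hand side is preserved because the weights sum to one.
    obtain rfl : b = 1 - a := by linarith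
    rcases i with i | i <;> simp <;> ring
  · have hQ : a • W₁ + b • W₂ - (κ / σ ^ 2) • (a • V₁ + b • V₂) =
        a • (W₁ - (κ / σ ^ 2) • V₁) + b • (W₂ - (κ / σ ^ 2) • V₂) := by module
    rw [hQ, Matrix.mul_add, Matrix.add_mul, Matrix.mul_smul, Matrix.mul_smul, Matrix.smul_mul,
      Matrix.smul_mul]

end SecureDelivery

theorem proposition1 (M Nt Ne : ℕ) (hNe : 0 < Ne) (σ ε Rtol : ℝ) (hσ : 0 < σ) (hε : 0 ≤ ε)
    (Ghat : Matrix (Fin (M * Nt)) (Fin Ne) ℂ)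
    (W V : Matrix (Fin (M * Nt)) (Fin (M * Nt)) ℂ)
    (hV : V.PosSemidef) (hW : W.PosSemidef) (hrank : W.rank ≤ 1) :
    (∃ w : Fin (M * Nt) → ℂ, W = SecureDelivery.outer w) ∧
    (∀ w : Fin (M * Nt) → ℂ, W = SecureDelivery.outer w →
      (0 < ε → (SecureDelivery.SecrecyConstraint σ ε Rtol Ghat w V ↔
        ∃ δ : ℝ, SecureDelivery.RobustLMI σ ε Rtol Ghat W V δ)) ∧
      (ε = 0 → (SecureDelivery.SecrecyConstraint σ ε Rtol Ghat w V ↔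
        SecureDelivery.NominalLMI σ Rtol Ghat W V))) ∧
    (0 < ε → Convex ℝ {p : Matrix (Fin (M * Nt)) (Fin (M * Nt)) ℂ ×
        Matrix (Fin (M * Nt)) (Fin (M * Nt)) ℂ × ℝ |
      SecureDelivery.RobustLMI σ ε Rtol Ghat p.1 p.2.1 p.2.2}) := by
  have : Nonempty (Fin Ne) := ⟨⟨0, hNe⟩⟩
  refine ⟨SecureDelivery.exists_eq_outer hW hrank, ?_,
    fun _ => SecureDelivery.convex_robustLMI σ ε Rtol Ghat⟩
  rintro w rfl
  rw [SecureDelivery.secrecyConstraint_iff hσ ε Rtol Ghat w hV]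
  refine ⟨fun hpos => SecureDelivery.forall_nominalLMI_iff hσ hpos Rtol Ghat hW.1 hV.1, ?_⟩
  rintro rfl
  simp [SecureDelivery.uncertaintySet_zero]
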